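/- Let $n\ge 1$ and $1<q<2$. Fix a smooth, nonnegative, even function $\chi:\mathbf R^n\to\mathbf R$ with $\chi(\xi)=1$ for $|\xi|\le 1$ and $\chi(\xi)=0$ for $|\xi|>2$, put $\varphi(\xi)=\chi(\xi)-\chi(2\xi)$, and for $l\in\mathbf Z$ let $$P_l g(\xi)=2^{ln}\int_{\mathbf R^n}\hat\varphi\big(2^l(\xi-\eta)\big)\,g(\eta)\,d\eta ,\qquad \hat f(\xi)=\int_{\mathbf R^n} f(x)e^{-2\pi i x\cdot\xi}\,dx ,$$ be the Littlewood--Paley operators; $P_l^\xi\sigma(x,\cdot)$ denotes $P_l$ applied to $\sigma(x,\cdot)$ for fixed $x$. Then there is a constant $C$, depending only on $n$, $q$ and $\chi$, such that the following holds. Let $\sigma:\mathbf R^n\times\mathbf R^n\to\mathbf C$ be a measurable function such that for every $x\in\mathbf R^n$ the function $\sigma(x,\cdot)$ vanishes at infinity in the weak sense that $\int_{\{\xi:\,|\sigma(x,\xi)|>\varepsilon\}}|\sigma(x,\xi)|\,d\xi<\infty$ for every $\varepsilon>0$ (for instance $\sigma(x,\cdot)\in L^p(\mathbf R^n)$ for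 some $1\le p<\infty$, or $\sigma(x,\cdot)\in C_0(\mathbf R^n)$). If $$\sum_{l\in\mathbf Z}2^{ln/q}\,\sup_{x\in\mathbf R^n}\|P_l^\xi\sigma(x,\cdot)\|_{L^q(\mathbf R^n)}<\infty ,$$ then the pseudodifferential operator $$T_\sigma f(x)=\int_{\mathbf R^n}\sigma(x,\xi)\,e^{2\pi i\xi\cdot x}\hat f(\xi)\,d\xi ,\qquad f\in\mathcal S(\mathbf R^n),$$ extends to a bounded operator on $L^q(\mathbf R^n)$, and $$\|T_\sigma\|_{L^q\to L^q}\le C\sum_{l\in\mathbf Z}2^{ln/q}\,\sup_{x\in\mathbf R^n}\|P_l^\xi\sigma(x,\cdot)\|_{L^q(\mathbf R^n)} .$$ -/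

import Mathlib

open MeasureTheory SchwartzMap
open scoped ENNReal NNReal FourierTransform ContDiff

namespace RoughPDO

/-- The Euclidean space `ℝⁿ`. -/
abbrev Rn (n : ℕ) : Type := EuclideanSpace ℝ (Fin n)

/-- A Littlewood-Paley cutoff on `ℝⁿ`: smooth, nonnegative, even, supported in `|ξ| ≤ 2` and equal
to `1` on `|ξ| ≤ 1`. -/
structure IsCutoff {n : ℕ} (χ : Rn n → ℝ) : Prop where
  smooth : ContDiff ℝ ∞ χ
  nonneg : ∀ ξ, 0 ≤ χ ξ
  even : ∀ ξ, χ (-ξ) = χ ξ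
  eq_zero : ∀ ξ, 2 < ‖ξ‖ → χ ξ = 0
  eq_one : ∀ ξ, ‖ξ‖ ≤ 1 → χ ξ = 1

/-- The Littlewood-Paley bump `φ(ξ) = χ(ξ) - χ(2ξ)`, as a complex valued function. -/
def bump {n : ℕ} (χ : Rn n → ℝ) (ξ : Rn n) : ℂ :=
  ((χ ξ - χ ((2 : ℝ) • ξ) : ℝ) : ℂ)

/-- The Littlewood-Paley operator
`P_l g(ξ) = 2^{ln} ∫ φ̂(2^l (ξ - η)) g(η) dη`, `l ∈ ℤ`. -/
noncomputable def littlewoodPaley {n : ℕ} (χ : Rn n → ℝ) (l : ℤ) (g : Rn n → ℂ) (ξ : Rn n) : ℂ :=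
  (2 : ℂ) ^ (l * (n : ℤ)) * ∫ η : Rn n, 𝓕 (bump χ) ((2 : ℝ) ^ l • (ξ - η)) * g η

/-- Admissible symbols `σ : ℝⁿ × ℝⁿ → ℂ`: (Lebesgue) measurable functions such that every
`σ(x, ·)` vanishes at infinity in the weak sense that `σ(x, ·) 1_{|σ(x, ·)| > ε}` is integrable for
all `ε > 0`, i.e. `σ(x, ·)` lies in the closure of `L¹` in `L¹ + L^∞`. -/
structure IsSymbol {n : ℕ} (σ : Rn n → Rn n → ℂ) : Prop where
  measurable : AEStronglyMeasurable (Function.uncurry σ) volume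
  vanishing : ∀ x : Rn n, ∀ ε : ℝ, 0 < ε →
    Integrable ({ξ : Rn n | ε < ‖σ x ξ‖}.indicator (σ x)) volume

/-- The pseudodifferential operator
`T_σ f(x) = ∫ σ(x, ξ) e^{2πi ξ·x} f̂(ξ) dξ` on Schwartz functions. -/
noncomputable def pdo {n : ℕ} (σ : Rn n → Rn n → ℂ) (f : 𝓢(Rn n, ℂ)) (x : Rn n) : ℂ :=
  ∫ ξ : Rn n, σ x ξ * Complex.exp (2 * Real.pi * Complex.I * (inner ℝ ξ x : ℝ)) *
    𝓕 (f : Rn n → ℂ) ξ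

/-- `∑_{l ∈ ℤ} 2^{ln/q} sup_x ‖P_l^ξ σ(x, ·)‖_{L^q}`, as an element of `[0, ∞]`. -/
noncomputable def symbolNorm {n : ℕ} (χ : Rn n → ℝ) (q : ℝ≥0∞) (σ : Rn n → Rn n → ℂ) : ℝ≥0∞ :=
  ∑' l : ℤ, (2 : ℝ≥0∞) ^ ((l : ℝ) * (n : ℝ) / q.toReal) *
    ⨆ x : Rn n, eLpNorm (littlewoodPaley χ l (σ x)) q volume

end RoughPDO

/-! The factor e^(2πiξ·x) in T_σ f(x) is absorbed by translation: T_σ f(x) pairs `σ x` with the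
Fourier transform of u = f(· + x) (`pdo_eq`). P_l is convolution with the transform of a bump
carried by |z| ≤ 2^(l+1), so by duality the l-th piece of `σ x` only sees u on a ball of radius
comparable to 2^l (`integral_littlewoodPaley_mul`, `mulMap_shell_dilate`). Hölder and
Hausdorff–Young, which is where q < 2 enters, bound that piece by ‖P_l σ(x,·)‖_q times the L^q norm
of f over the ball of radius 2^(l+2) about x. In L^q of x, Tonelli turns the local norm into a
multiple of 2^(ln/q) ‖f‖_q, and Minkowski sums over l.

The pieces must also rebuild the pairing. Each P_l kills constants, so some decay of the symbol is
needed. Weak vanishing suffices: the remainders of the partial sums have Fourier transforms that are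
bounded in L¹ and tend to zero uniformly (`tendsto_integral_mul_fourier_mulMap`). -/

/-! ### Hausdorff–Young by real interpolation between L¹ → L^∞ and Plancherel. -/

section HausdorffYoung

variable {V : Type*} [NormedAddCommGroup V] [InnerProductSpace ℝ V] [FiniteDimensional ℝ V]

/-- A Schwartz function splits smoothly at height `t` into a large and a small part. -/
theorem SchwartzMap.exists_add_eq_large_small (g : 𝓢(V, ℂ)) {t : ℝ} (ht : 0 < t) :
    ∃ g₁ g₂ : 𝓢(V, ℂ), g = g₁ + g₂ ∧ (∀ x, ‖g₁ x‖ ≤ ‖g x‖) ∧ (∀ x, ‖g x‖ ≤ t → g₁ x = 0) ∧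
      (∀ x, ‖g₂ x‖ ≤ ‖g x‖) ∧ (∀ x, 2 * t < ‖g x‖ → g₂ x = 0) := by
  -- The squared norm keeps θ smooth at zeros of g. The transition takes place for |g| between t and
  -- √2 t, inside the allowed range [t, 2t].
  set θ : V → ℝ := fun x ↦ Real.smoothTransition (2 - ‖g x‖ ^ 2 / t ^ 2) with hθ
  have hθ0 : ∀ x, 0 ≤ θ x := fun x ↦ Real.smoothTransition.nonneg _
  have hθ1 : ∀ x, θ x ≤ 1 := fun x ↦ Real.smoothTransition.le_one _
  have hsmall : ∀ x, ‖g x‖ ≤ t → θ x = 1 := fun x hx ↦ by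
    apply Real.smoothTransition.one_of_one_le
    have : ‖g x‖ ^ 2 / t ^ 2 ≤ 1 := by
      rw [div_le_one (by positivity)]
      gcongr
    linarith
  have hlarge : ∀ x, 2 * t < ‖g x‖ → θ x = 0 := fun x hx ↦ by
    apply Real.smoothTransition.zero_of_nonpos
    have : 2 ≤ ‖g x‖ ^ 2 / t ^ 2 := by
      rw [le_div_iff₀ (by positivity)]
      nlinarith
    linarith
  have hsm : ContDiff ℝ ∞ θ :=
    Real.smoothTransition.contDiff.comp
      (contDiff_const.sub (((g.smooth ⊤).norm_sq ℂ).div_const _))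
  -- Since g tends to zero at infinity, 1 - θ vanishes off a compact set.
  have hcs : HasCompactSupport (fun x ↦ (((1 - θ x : ℝ) : ℂ)) * g x) := by
    rw [hasCompactSupport_iff_eventuallyEq, Filter.coclosedCompact_eq_cocompact]
    have := (g.toZeroAtInfty.zero_at_infty').norm
    have h2 : ∀ᶠ x in Filter.cocompact V, ‖g x‖ < t := by
      have h3 := this.eventually_lt_const (show ‖(0 : ℂ)‖ < t by simpa using ht)
      exact h3
    filter_upwards [h2] with x hx
    simp [hsmall x hx.le]
  have hcd : ContDiff ℝ ∞ (fun x ↦ (((1 - θ x : ℝ) : ℂ)) * g x) :=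
    (Complex.ofRealCLM.contDiff.comp (contDiff_const.sub hsm)).mul (g.smooth ⊤)
  set g₁ := hcs.toSchwartzMap hcd
  have hg₁ : ∀ x, g₁ x = ((1 - θ x : ℝ) : ℂ) * g x := fun x ↦ rfl
  have hg₂ : ∀ x, (g - g₁) x = ((θ x : ℝ) : ℂ) * g x := fun x ↦ by
    rw [sub_apply, hg₁]; push_cast; ring
  refine ⟨g₁, g - g₁, by simp, fun x ↦ ?_, fun x hx ↦ ?_, fun x ↦ ?_, fun x hx ↦ ?_⟩
  · rw [hg₁, norm_mul, Complex.norm_real, Real.norm_of_nonneg (by linarith [hθ1 x])]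
    exact mul_le_of_le_one_left (norm_nonneg _) (by linarith [hθ0 x])
  · simp [hg₁, hsmall x hx]
  · rw [hg₂, norm_mul, Complex.norm_real, Real.norm_of_nonneg (hθ0 x)]
    exact mul_le_of_le_one_left (norm_nonneg _) (hθ1 x)
  · rw [hg₂, hlarge x hx]; simp

variable [MeasurableSpace V] [BorelSpace V]

theorem SchwartzMap.integrable_norm_rpow (g : 𝓢(V, ℂ)) {p : ℝ} (hp : 0 < p) :
    Integrable (fun x ↦ ‖g x‖ ^ p) := by
  have := (g.memLp (ENNReal.ofReal p)).integrable_norm_rpow (by simpa using hp) (by simp)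
  simpa [ENNReal.toReal_ofReal hp.le] using this

theorem SchwartzMap.lintegral_fourier_sq (g : 𝓢(V, ℂ)) :
    ∫⁻ ξ, ENNReal.ofReal (‖𝓕 g ξ‖ ^ 2) = ∫⁻ x, ENNReal.ofReal (‖g x‖ ^ 2) := by
  have h (f : 𝓢(V, ℂ)) : Integrable (fun x ↦ ‖f x‖ ^ 2) := by
    simpa using f.integrable_norm_rpow two_pos
  rw [← ofReal_integral_eq_lintegral_ofReal (h _) (ae_of_all _ fun _ ↦ by positivity),
    ← ofReal_integral_eq_lintegral_ofReal (h _) (ae_of_all _ fun _ ↦ by positivity),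
    integral_norm_sq_fourier]

/-- The distribution function of a Fourier transform is controlled by the small values
of the function. -/
theorem SchwartzMap.meas_lt_norm_fourier_le (g : 𝓢(V, ℂ)) {p s t : ℝ} (hp : 1 < p) (hs : 0 < s)
    (ht : 0 < t) (h : t ^ (1 - p) * ∫ x, ‖g x‖ ^ p ≤ s / 2) :
    volume {ξ | s < ‖𝓕 g ξ‖} ≤
      ENNReal.ofReal (4 / s ^ 2) * ∫⁻ x in {x | ‖g x‖ ≤ 2 * t}, ENNReal.ofReal (‖g x‖ ^ 2) := by
  obtain ⟨g₁, g₂, hg, h1, h1', h2, h2'⟩ := g.exists_add_eq_large_small ht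
  -- The large part lives on |g| > t, where |g| ≤ t^(1-p) |g|^p, so its L¹ norm is at most s / 2.
  -- Only the small part can then push the transform above s.
  have hF1 : ∀ ξ, ‖𝓕 g₁ ξ‖ ≤ s / 2 := fun ξ ↦ by
    refine (norm_fourier_apply_le_toLp_one g₁ ξ).trans (le_trans ?_ h)
    rw [norm_toLp_one, ← integral_const_mul]
    refine integral_mono g₁.integrable.norm ((g.integrable_norm_rpow (by linarith)).const_mul _)
      fun x ↦ ?_
    rcases le_or_gt ‖g x‖ t with hx | hx
    · simp only [h1' x hx, norm_zero]; positivity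
    · have hgx : 0 < ‖g x‖ := ht.trans hx
      calc ‖g₁ x‖ ≤ ‖g x‖ := h1 x
        _ = ‖g x‖ ^ (1 - p) * ‖g x‖ ^ p := by rw [← Real.rpow_add hgx]; simp
        _ ≤ t ^ (1 - p) * ‖g x‖ ^ p := by
          gcongr ?_ * _
          exact Real.rpow_le_rpow_of_nonpos ht hx.le (by linarith)
  have hsub : {ξ | s < ‖𝓕 g ξ‖} ⊆
      {ξ | ENNReal.ofReal ((s / 2) ^ 2) ≤ ENNReal.ofReal (‖𝓕 g₂ ξ‖ ^ 2)} := fun ξ hξ ↦ by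
    have : 𝓕 g ξ = 𝓕 g₁ ξ + 𝓕 g₂ ξ := by rw [hg, FourierTransform.fourier_add]; rfl
    have h3 := norm_add_le (𝓕 g₁ ξ) (𝓕 g₂ ξ)
    rw [← this] at h3
    have h4 := hF1 ξ
    have h5 : s < ‖𝓕 g ξ‖ := hξ
    apply ENNReal.ofReal_le_ofReal
    gcongr
    linarith
  have hm : Measurable fun ξ ↦ ENNReal.ofReal (‖𝓕 g₂ ξ‖ ^ 2) :=
    ((𝓕 g₂).continuous.norm.pow 2).measurable.ennreal_ofReal
  -- Chebyshev's inequality in L², followed by Plancherel.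
  have hch := mul_meas_ge_le_lintegral (μ := volume) hm (ENNReal.ofReal ((s / 2) ^ 2))
  rw [lintegral_fourier_sq] at hch
  have hle : ∫⁻ x, ENNReal.ofReal (‖g₂ x‖ ^ 2) ≤
      ∫⁻ x in {x | ‖g x‖ ≤ 2 * t}, ENNReal.ofReal (‖g x‖ ^ 2) := by
    rw [← lintegral_indicator (measurableSet_le g.continuous.norm.measurable measurable_const)]
    refine lintegral_mono fun x ↦ ?_
    by_cases hx : ‖g x‖ ≤ 2 * t
    · rw [Set.indicator_of_mem (s := {x | ‖g x‖ ≤ 2 * t}) hx]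
      apply ENNReal.ofReal_le_ofReal
      gcongr
      exact h2 x
    · simp [h2' x (not_le.1 hx)]
  have h6 : ENNReal.ofReal (4 / s ^ 2) * ENNReal.ofReal ((s / 2) ^ 2) = 1 := by
    rw [← ENNReal.ofReal_mul (by positivity)]
    rw [show 4 / s ^ 2 * (s / 2) ^ 2 = 1 by field_simp; norm_num]
    simp
  calc volume {ξ | s < ‖𝓕 g ξ‖}
      ≤ volume {ξ | ENNReal.ofReal ((s / 2) ^ 2) ≤ ENNReal.ofReal (‖𝓕 g₂ ξ‖ ^ 2)} :=
        measure_mono hsub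
    _ = ENNReal.ofReal (4 / s ^ 2) * (ENNReal.ofReal ((s / 2) ^ 2) *
          volume {ξ | ENNReal.ofReal ((s / 2) ^ 2) ≤ ENNReal.ofReal (‖𝓕 g₂ ξ‖ ^ 2)}) := by
        rw [← mul_assoc, h6, one_mul]
    _ ≤ _ := by gcongr; exact hch.trans hle

theorem lintegral_Ioc_ofReal_rpow {a S : ℝ} (ha : -1 < a) (hS : 0 ≤ S) :
    ∫⁻ s in Set.Ioc 0 S, ENNReal.ofReal (s ^ a) = ENNReal.ofReal (S ^ (a + 1) / (a + 1)) := by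
  have hi := (intervalIntegral.intervalIntegrable_rpow' (a := 0) (b := S) ha)
  rw [intervalIntegrable_iff_integrableOn_Ioc_of_le hS] at hi
  rw [← ofReal_integral_eq_lintegral_ofReal hi, ← intervalIntegral.integral_of_le hS,
    integral_rpow (Or.inl ha), Real.zero_rpow (by linarith), sub_zero]
  filter_upwards [self_mem_ae_restrict measurableSet_Ioc] with s hs
  exact Real.rpow_nonneg hs.1.le _

/-- The Hausdorff-Young inequality for Schwartz functions, up to a constant. -/
theorem SchwartzMap.lintegral_fourier_rpow_le {p r : ℝ} (hpr : p.HolderConjugate r) (hp2 : p < 2) :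
    ∃ C : ℝ, 0 ≤ C ∧ ∀ g : 𝓢(V, ℂ), ∫⁻ ξ, ENNReal.ofReal (‖𝓕 g ξ‖ ^ r) ≤
      ENNReal.ofReal (C * (∫ x, ‖g x‖ ^ p) ^ (r - 1)) := by
  have hp : 1 < p := hpr.lt
  have hr1 : 1 < r := hpr.symm.lt
  have hrp : (p - 1) * (r - 1) = 1 := by linarith [hpr.mul_eq_add]
  have hr2 : 2 < r := by nlinarith
  refine ⟨r * (4 * (2 ^ (r - 2) * 2 ^ (2 - p) / (r - 2))), ?_, fun g ↦ ?_⟩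
  · have : 0 < r - 2 := by linarith
    positivity
  set A := ∫ x, ‖g x‖ ^ p with hA
  have hA0 : 0 ≤ A := integral_nonneg fun x ↦ by positivity
  -- The height τ below divides by A, so g = 0 a.e. is treated apart.
  rcases hA0.eq_or_lt with h0 | hApos
  · have hz := (integral_eq_zero_iff_of_nonneg (fun x ↦ by positivity)
      (g.integrable_norm_rpow (p := p) (by linarith))).1 h0.symm
    have hz' : (g : V → ℂ) =ᵐ[volume] 0 := by
      filter_upwards [hz] with x hx
      simpa [Real.rpow_eq_zero (norm_nonneg (g x)) (by linarith : p ≠ 0)] using hx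
    have hF : ∀ ξ, 𝓕 g ξ = 0 := fun ξ ↦ by
      rw [fourier_coe, Real.fourier_congr_ae hz']
      simp [Real.fourier_eq]
    simp [hF, Real.zero_rpow (by linarith : r ≠ 0)]
  -- The height solving τ^(1-p) A = s / 2, by (p - 1)(r - 1) = 1.
  set τ : ℝ → ℝ := fun s ↦ (s / (2 * A)) ^ (-(r - 1)) with hτ
  have hτpos : ∀ s, 0 < s → 0 < τ s := fun s hs ↦ by positivity
  have hτA : ∀ s, 0 < s → τ s ^ (1 - p) * A = s / 2 := fun s hs ↦ by
    rw [hτ, ← Real.rpow_mul (by positivity),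
      show -(r - 1) * (1 - p) = 1 by linarith, Real.rpow_one]
    field_simp
  rw [lintegral_rpow_eq_lintegral_meas_lt_mul volume (ae_of_all _ fun ξ ↦ norm_nonneg _)
    (𝓕 g).continuous.norm.measurable.aemeasurable (by linarith : 0 < r)]
  rw [mul_assoc r, ENNReal.ofReal_mul (by linarith : 0 ≤ r)]
  gcongr
  -- The layer-cake integrand as one function on the product, ready for Tonelli. The power r - 3
  -- comes from s^(r-1) · 4 / s².
  set H : ℝ → V → ℝ≥0∞ := fun s x ↦ {y : ℝ × V | 0 < y.1 ∧ ‖g y.2‖ ≤ 2 * τ y.1}.indicator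
    (fun y ↦ ENNReal.ofReal (4 * ‖g y.2‖ ^ 2 * y.1 ^ (r - 3))) (s, x) with hH
  have hgm : Measurable fun y : ℝ × V ↦ ‖g y.2‖ := by
    have := g.continuous; fun_prop
  have hHm : Measurable (Function.uncurry H) := by
    refine Measurable.indicator (by fun_prop) ?_
    refine (measurableSet_lt measurable_const measurable_fst).inter
      (measurableSet_le hgm (by fun_prop))
  have hstep : ∫⁻ s in Set.Ioi 0, volume {ξ | s < ‖𝓕 g ξ‖} * ENNReal.ofReal (s ^ (r - 1)) ≤
      ∫⁻ s in Set.Ioi 0, ∫⁻ x, H s x := by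
    refine setLIntegral_mono' measurableSet_Ioi fun s hs ↦ ?_
    have hs : 0 < s := hs
    grw [g.meas_lt_norm_fourier_le hp hs (hτpos s hs) (hτA s hs).le]
    rw [← lintegral_indicator (measurableSet_le g.continuous.norm.measurable measurable_const),
      mul_comm, ← mul_assoc, ← lintegral_const_mul' _ _ (by finiteness)]
    refine lintegral_mono fun x ↦ ?_
    by_cases hx : ‖g x‖ ≤ 2 * τ s
    · rw [Set.indicator_of_mem (s := {x | ‖g x‖ ≤ 2 * τ s}) hx, hH]
      simp only
      rw [Set.indicator_of_mem (show (s, x) ∈ {y : ℝ × V | 0 < y.1 ∧ ‖g y.2‖ ≤ 2 * τ y.1}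
        from ⟨hs, hx⟩), ← ENNReal.ofReal_mul (by positivity),
        ← ENNReal.ofReal_mul (by positivity)]
      apply ENNReal.ofReal_le_ofReal
      apply le_of_eq
      simp only
      rw [show r - 1 = (r - 3) + 2 by ring, Real.rpow_add hs]
      norm_num
      field_simp
    · rw [Set.indicator_of_notMem (s := {x | ‖g x‖ ≤ 2 * τ s}) hx]; simp
  refine hstep.trans ?_
  rw [lintegral_lintegral_swap hHm.aemeasurable]
  have hin : ∀ x, ∫⁻ s in Set.Ioi 0, H s x ≤
      ENNReal.ofReal (4 * (2 ^ (r - 2) * 2 ^ (2 - p) / (r - 2)) * A ^ (r - 2) * ‖g x‖ ^ p) := by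
    intro x
    rcases (norm_nonneg (g x)).eq_or_lt with hx0 | hx0
    · have : ∀ s, H s x = 0 := fun s ↦ by
        rw [hH]; simp only; rw [Set.indicator_apply]
        simp [← hx0]
      simp [this]
    -- Solving |g x| ≤ 2 τ(s) for s gives s ≤ S.
    set S := 2 * A * (‖g x‖ / 2) ^ (-(p - 1)) with hS
    have hS0 : 0 ≤ S := by positivity
    calc ∫⁻ s in Set.Ioi 0, H s x
        ≤ ∫⁻ s in Set.Ioi 0, (Set.Ioc 0 S).indicator
            (fun s ↦ ENNReal.ofReal (4 * ‖g x‖ ^ 2) * ENNReal.ofReal (s ^ (r - 3))) s := by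
          refine setLIntegral_mono' measurableSet_Ioi fun s hs ↦ ?_
          have hs : 0 < s := hs
          by_cases hx : ‖g x‖ ≤ 2 * τ s
          · have hmem : s ∈ Set.Ioc 0 S := by
              refine ⟨hs, ?_⟩
              have h1 : ‖g x‖ / 2 ≤ τ s := by linarith
              have h2 := Real.rpow_le_rpow_of_nonpos (by positivity) h1
                (by linarith : -(p - 1) ≤ 0)
              rw [hτ, ← Real.rpow_mul (by positivity),
                show -(r - 1) * (-(p - 1)) = 1 by linarith, Real.rpow_one,
                div_le_iff₀ (by positivity)] at h2
              rw [hS]; linarith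
            rw [Set.indicator_of_mem hmem, ← ENNReal.ofReal_mul (by positivity)]
            rw [hH]
            simp only
            rw [Set.indicator_of_mem (show (s, x) ∈ {y : ℝ × V | 0 < y.1 ∧ ‖g y.2‖ ≤ 2 * τ y.1}
              from ⟨hs, hx⟩)]
          · rw [hH]; simp only; rw [Set.indicator_of_notMem (fun h ↦ hx h.2)]; simp
      _ ≤ ∫⁻ s, (Set.Ioc 0 S).indicator
            (fun s ↦ ENNReal.ofReal (4 * ‖g x‖ ^ 2) * ENNReal.ofReal (s ^ (r - 3))) s :=
          setLIntegral_le_lintegral _ _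
      _ = ENNReal.ofReal (4 * ‖g x‖ ^ 2) * ENNReal.ofReal (S ^ (r - 3 + 1) / (r - 3 + 1)) := by
          -- Integrability at zero needs r - 3 > -1, that is p < 2.
          rw [lintegral_indicator measurableSet_Ioc, lintegral_const_mul' _ _ (by finiteness),
            lintegral_Ioc_ofReal_rpow (by linarith) hS0]
      _ ≤ _ := by
          rw [← ENNReal.ofReal_mul (by positivity)]
          apply ENNReal.ofReal_le_ofReal
          apply le_of_eq
          have e1 : S ^ (r - 3 + 1) = 2 ^ (r - 2) * A ^ (r - 2) * (‖g x‖ ^ (p - 2) * 2 ^ (2 - p)) := by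
            rw [show r - 3 + 1 = r - 2 by ring, hS, Real.mul_rpow (by positivity) (by positivity),
              Real.mul_rpow (by positivity) (by positivity), ← Real.rpow_mul (by positivity),
              show -(p - 1) * (r - 2) = p - 2 by linarith,
              Real.div_rpow (by positivity) (by positivity), div_eq_mul_inv,
              ← Real.rpow_neg (by positivity), neg_sub]
          have e2 : ‖g x‖ ^ p = ‖g x‖ ^ (p - 2) * ‖g x‖ ^ 2 := by
            rw [← Real.rpow_natCast, ← Real.rpow_add hx0]; norm_num
          rw [e1, e2, show r - 3 + 1 = r - 2 by ring]
          ring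
  refine (lintegral_mono hin).trans ?_
  have hr20 : 0 < r - 2 := by linarith
  rw [← ofReal_integral_eq_lintegral_ofReal
    ((g.integrable_norm_rpow (by linarith)).const_mul _) (ae_of_all _ fun x ↦ by positivity),
    integral_const_mul, ← hA]
  apply ENNReal.ofReal_le_ofReal
  apply le_of_eq
  rw [show r - 1 = (r - 2) + 1 by ring, Real.rpow_add hApos, Real.rpow_one]
  ring

end HausdorffYoung

/-! ### Products of Schwartz functions and their Fourier transforms. -/

section Product

variable {V : Type*} [NormedAddCommGroup V] [InnerProductSpace ℝ V] [FiniteDimensional ℝ V]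
  [MeasurableSpace V] [BorelSpace V]

/-- The pointwise product of two Schwartz functions. -/
noncomputable def SchwartzMap.mulMap (w u : 𝓢(V, ℂ)) : 𝓢(V, ℂ) :=
  pairing (ContinuousLinearMap.mul ℂ ℂ) w u

omit [FiniteDimensional ℝ V] [MeasurableSpace V] [BorelSpace V] in
@[simp]
theorem SchwartzMap.mulMap_apply (w u : 𝓢(V, ℂ)) (x : V) : mulMap w u x = w x * u x := rfl

/-- The Fourier transform of a product is the convolution of the Fourier transforms. -/
theorem SchwartzMap.fourier_mulMap_apply (w u : 𝓢(V, ℂ)) (η : V) :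
    𝓕 (mulMap w u) η = ∫ ξ, 𝓕 w (η - ξ) * 𝓕 u ξ := by
  have hff (f : 𝓢(V, ℂ)) (x : V) : 𝓕 (𝓕 f) (-x) = f x := by
    have h := congrArg (fun g : 𝓢(V, ℂ) ↦ g x) (FourierTransform.fourierInv_fourier_eq (F := 𝓢(V, ℂ)) f)
    simp only [fourierInv_coe, Real.fourierInv_eq_fourier_neg] at h
    exact h
  have h := convolution_apply (ContinuousLinearMap.mul ℂ ℂ) (𝓕 u) (𝓕 w) η
  rw [convolution_def] at h
  simp only [ContinuousLinearMap.mul_apply'] at h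
  simp_rw [mul_comm (𝓕 w _)]
  rw [← h]
  -- Convolution of Schwartz functions unfolds to the inverse transform of the product of
  -- transforms. The double transforms are reflections, which turn 𝓕⁻ into 𝓕.
  change _ = 𝓕⁻ (pairing (ContinuousLinearMap.mul ℂ ℂ) (𝓕 (𝓕 u)) (𝓕 (𝓕 w))) η
  rw [fourierInv_coe, Real.fourierInv_eq_fourier_comp_neg, fourier_coe]
  refine congrArg (fun F : V → ℂ ↦ 𝓕 F η) (funext fun x ↦ ?_)
  simp [hff, mul_comm]

theorem SchwartzMap.fourier_neg_of_even {w : 𝓢(V, ℂ)} (hw : ∀ x, w (-x) = w x) (ξ : V) :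
    𝓕 w (-ξ) = 𝓕 w ξ := by
  rw [fourier_coe, ← Real.fourierInv_eq_fourier_neg, Real.fourierInv_eq_fourier_comp_neg]
  refine congrArg (fun F : V → ℂ ↦ 𝓕 F ξ) (funext fun x ↦ ?_)
  exact hw x

theorem SchwartzMap.integral_norm_fourier_mulMap_le (w u : 𝓢(V, ℂ)) :
    ∫ η, ‖𝓕 (mulMap w u) η‖ ≤ (∫ ξ, ‖𝓕 w ξ‖) * ∫ ξ, ‖𝓕 u ξ‖ := by
  have hi : Integrable (fun p : V × V ↦ ‖𝓕 u p.2‖ * ‖𝓕 w (p.1 - p.2)‖) :=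
    (𝓕 u).integrable.norm.convolution_integrand (ContinuousLinearMap.mul ℝ ℝ) (𝓕 w).integrable.norm
  calc ∫ η, ‖𝓕 (mulMap w u) η‖ ≤ ∫ η, ∫ ξ, ‖𝓕 u ξ‖ * ‖𝓕 w (η - ξ)‖ := by
        refine integral_mono (𝓕 (mulMap w u)).integrable.norm hi.integral_prod_left fun η ↦ ?_
        simp only [fourier_mulMap_apply]
        refine (norm_integral_le_integral_norm _).trans_eq ?_
        simp_rw [norm_mul, mul_comm]
    _ = ∫ ξ, ∫ η, ‖𝓕 u ξ‖ * ‖𝓕 w (η - ξ)‖ := integral_integral_swap hi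
    _ = _ := by
        simp_rw [integral_const_mul, integral_sub_right_eq_self (fun η ↦ ‖𝓕 w η‖)]
        rw [integral_mul_const, mul_comm]

end Product

/-! ### Pairings with weakly vanishing functions. -/

section Vanishing

variable {V : Type*} [MeasurableSpace V]
  {μ : Measure V}

/-- `g` vanishes at infinity in the weak sense that it is integrable where it exceeds any
given positive level. -/
def VanishesWeakly (g : V → ℂ) (μ : Measure V) : Prop :=
  ∀ ε : ℝ, 0 < ε → Integrable ({ξ : V | ε < ‖g ξ‖}.indicator g) μ

namespace VanishesWeakly

variable {g : V → ℂ}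

/-- The truncations at levels 1 / (k + 1) are measurable and converge pointwise to g. -/
theorem aestronglyMeasurable (hg : VanishesWeakly g μ) : AEStronglyMeasurable g μ := by
  refine aestronglyMeasurable_of_tendsto_ae Filter.atTop
    (f := fun k : ℕ ↦ {ξ : V | 1 / ((k : ℝ) + 1) < ‖g ξ‖}.indicator g)
    (fun k ↦ (hg _ (by positivity)).aestronglyMeasurable) (ae_of_all _ fun ξ ↦ ?_)
  rcases eq_or_ne (g ξ) 0 with h0 | h0
  · simp [Set.indicator_apply, h0]
  · refine tendsto_const_nhds.congr' ?_
    filter_upwards [tendsto_one_div_add_atTop_nhds_zero_nat.eventually_lt_const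
      (norm_pos_iff.2 h0)] with k hk
    rw [Set.indicator_of_mem (s := {ξ : V | 1 / ((k : ℝ) + 1) < ‖g ξ‖}) hk]

/-- Such a function is the sum of an integrable and of a uniformly small function. -/
theorem exists_add (hg : VanishesWeakly g μ) {ε : ℝ} (hε : 0 < ε) :
    ∃ g₁ g₂ : V → ℂ, g = g₁ + g₂ ∧ Integrable g₁ μ ∧ AEStronglyMeasurable g₂ μ ∧
      ∀ ξ, ‖g₂ ξ‖ ≤ ε := by
  refine ⟨{ξ : V | ε < ‖g ξ‖}.indicator g, {ξ : V | ε < ‖g ξ‖}ᶜ.indicator g,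
    (Set.indicator_self_add_compl _ _).symm, hg ε hε, ?_, fun ξ ↦ ?_⟩
  · rw [Set.indicator_compl]
    exact hg.aestronglyMeasurable.sub (hg ε hε).aestronglyMeasurable
  · by_cases h : ε < ‖g ξ‖
    · rw [Set.indicator_of_notMem (by simpa using h)]
      simpa using hε.le
    · rw [Set.indicator_of_mem (by simpa using h)]
      exact not_lt.1 h

theorem integrable_mul (hg : VanishesWeakly g μ) {h : V → ℂ} (hh : Integrable h μ) {M : ℝ}
    (hM : ∀ ξ, ‖h ξ‖ ≤ M) : Integrable (fun ξ ↦ g ξ * h ξ) μ := by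
  obtain ⟨g₁, g₂, rfl, h1, h2, h2'⟩ := hg.exists_add one_pos
  simp only [Pi.add_apply, add_mul]
  exact (h1.mul_bdd hh.aestronglyMeasurable (ae_of_all _ hM)).add
    (hh.bdd_mul h2 (ae_of_all _ h2'))

/-- Pairings with a weakly vanishing function tend to zero along sequences which are bounded in
`L¹` and tend to zero uniformly. -/
theorem tendsto_integral_mul (hg : VanishesWeakly g μ) {h : ℕ → V → ℂ} {δ : ℕ → ℝ} {M : ℝ}
    (hh : ∀ N, Integrable (h N) μ) (hM : ∀ N, ∫ ξ, ‖h N ξ‖ ∂μ ≤ M) (hδ : ∀ N ξ, ‖h N ξ‖ ≤ δ N)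
    (hδ0 : Filter.Tendsto δ Filter.atTop (nhds 0)) :
    Filter.Tendsto (fun N ↦ ∫ ξ, g ξ * h N ξ ∂μ) Filter.atTop (nhds 0) := by
  have hM0 : 0 ≤ M := (integral_nonneg fun _ ↦ norm_nonneg _).trans (hM 0)
  rw [Metric.tendsto_nhds]
  intro ε hε
  -- This level leaves at most ε / 2 from g₂ against the L¹ bound M; M + 1 avoids division by zero.
  -- The integrable part g₁ is handled by uniform decay.
  obtain ⟨g₁, g₂, rfl, h1, h2, h2'⟩ := hg.exists_add (ε := ε / (2 * (M + 1))) (by positivity)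
  have hlim : Filter.Tendsto (fun N ↦ (∫ ξ, ‖g₁ ξ‖ ∂μ) * δ N) Filter.atTop (nhds 0) := by
    simpa using hδ0.const_mul (∫ ξ, ‖g₁ ξ‖ ∂μ)
  filter_upwards [hlim.eventually_lt_const (half_pos hε)] with N hN
  have i1 : Integrable (fun ξ ↦ g₁ ξ * h N ξ) μ :=
    h1.mul_bdd (hh N).aestronglyMeasurable (ae_of_all _ (hδ N))
  have i2 : Integrable (fun ξ ↦ g₂ ξ * h N ξ) μ := (hh N).bdd_mul h2 (ae_of_all _ h2')
  have b1 : ‖∫ ξ, g₁ ξ * h N ξ ∂μ‖ ≤ (∫ ξ, ‖g₁ ξ‖ ∂μ) * δ N := by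
    rw [← integral_mul_const]
    refine norm_integral_le_of_norm_le (h1.norm.mul_const _) (ae_of_all _ fun ξ ↦ ?_)
    rw [norm_mul]
    exact mul_le_mul_of_nonneg_left (hδ N ξ) (norm_nonneg _)
  have b2 : ‖∫ ξ, g₂ ξ * h N ξ ∂μ‖ ≤ ε / 2 := by
    calc ‖∫ ξ, g₂ ξ * h N ξ ∂μ‖ ≤ ∫ ξ, ε / (2 * (M + 1)) * ‖h N ξ‖ ∂μ := by
          refine norm_integral_le_of_norm_le ((hh N).norm.const_mul _) (ae_of_all _ fun ξ ↦ ?_)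
          rw [norm_mul]
          exact mul_le_mul_of_nonneg_right (h2' ξ) (norm_nonneg _)
      _ ≤ ε / (2 * (M + 1)) * (M + 1) := by
          rw [integral_const_mul]
          gcongr
          linarith [hM N]
      _ = ε / 2 := by field_simp
  simp only [Pi.add_apply, add_mul]
  rw [dist_zero_right, integral_add i1 i2]
  exact (norm_add_le _ _).trans_lt (by linarith)

end VanishesWeakly

/-- Fubini applies after splitting g: the integrable part uses that h is bounded, the bounded part
that K(ξ - η) h(ξ) is jointly integrable. -/
theorem VanishesWeakly.integral_convolution_mul {V : Type*} [NormedAddCommGroup V]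
    [InnerProductSpace ℝ V] [FiniteDimensional ℝ V] [MeasurableSpace V] [BorelSpace V]
    {g : V → ℂ} (hg : VanishesWeakly g volume) (K h : 𝓢(V, ℂ)) :
    ∫ ξ, (∫ η, K (ξ - η) * g η) * h ξ = ∫ η, g η * ∫ ξ, K (ξ - η) * h ξ := by
  obtain ⟨g₁, g₂, hg12, h1, h2, h2'⟩ := hg.exists_add one_pos
  obtain ⟨M, hM⟩ : ∃ M : ℝ, ∀ ξ, ‖h ξ‖ ≤ M := ⟨_, norm_le_seminorm ℝ h⟩
  have hi : Integrable (fun p : V × V ↦ K (p.1 - p.2) * g p.2 * h p.1) := by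
    have i1 : Integrable (fun p : V × V ↦ g₁ p.2 * K (p.1 - p.2)) :=
      h1.convolution_integrand (ContinuousLinearMap.mul ℂ ℂ) K.integrable
    have i2 : Integrable (fun p : V × V ↦ h p.1 * K (p.1 - p.2)) := by
      have := (h.integrable (μ := volume)).convolution_integrand (ContinuousLinearMap.mul ℂ ℂ)
        (K.integrable (μ := volume)).comp_neg
      simpa [Function.comp_def] using! this.swap
    have i1' := i1.mul_bdd (g := fun p : V × V ↦ h p.1)
      (h.continuous.comp continuous_fst).aestronglyMeasurable (ae_of_all _ fun p ↦ hM p.1)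
    have i2' := i2.bdd_mul (f := fun p : V × V ↦ g₂ p.2) h2.comp_snd
      (ae_of_all _ fun p ↦ h2' p.2)
    refine (i1'.add i2').congr (ae_of_all _ fun p ↦ ?_)
    simp only [hg12, Pi.add_apply]
    ring
  calc ∫ ξ, (∫ η, K (ξ - η) * g η) * h ξ = ∫ ξ, ∫ η, K (ξ - η) * g η * h ξ := by
        simp_rw [integral_mul_const]
    _ = ∫ η, ∫ ξ, K (ξ - η) * g η * h ξ := integral_integral_swap hi
    _ = _ := by
        simp_rw [← integral_const_mul]
        congr! 4
        ring

end Vanishing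

/-! ### Dyadic dilations, and Hausdorff–Young in norm form. -/

section Dilation

variable {V : Type*} [NormedAddCommGroup V] [InnerProductSpace ℝ V]

/-- The dyadic dilation `x ↦ ψ (2⁻ᵏ x)` of a Schwartz function. -/
noncomputable def SchwartzMap.dilate (k : ℤ) (ψ : 𝓢(V, ℂ)) : 𝓢(V, ℂ) :=
  compCLMOfContinuousLinearEquiv ℂ
    (ContinuousLinearEquiv.smulLeft (Units.mk0 ((2 : ℝ) ^ (-k)) (by positivity))) ψ

theorem SchwartzMap.dilate_apply (k : ℤ) (ψ : 𝓢(V, ℂ)) (x : V) :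
    dilate k ψ x = ψ ((2 : ℝ) ^ (-k) • x) := rfl

variable [FiniteDimensional ℝ V] [MeasurableSpace V] [BorelSpace V]

theorem SchwartzMap.fourier_dilate_apply (k : ℤ) (ψ : 𝓢(V, ℂ)) (ξ : V) :
    𝓕 (dilate k ψ) ξ = (2 : ℂ) ^ (k * (Module.finrank ℝ V : ℤ)) * 𝓕 ψ ((2 : ℝ) ^ k • ξ) := by
  have h := Measure.integral_comp_inv_smul volume
    (fun v : V ↦ Real.fourierChar (-inner ℝ v ((2 : ℝ) ^ k • ξ)) • ψ v) ((2 : ℝ) ^ k)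
  rw [fourier_coe, fourier_coe, Real.fourier_eq, Real.fourier_eq]
  simp only [inner_smul_left, inner_smul_right, map_inv₀, conj_trivial] at h ⊢
  have h0 : ((2 : ℝ) ^ k) ≠ 0 := by positivity
  simp only [← mul_assoc, mul_inv_cancel₀ h0, one_mul] at h
  simp only [dilate_apply, zpow_neg]
  rw [h, abs_of_pos (by positivity), ← zpow_natCast, ← zpow_mul, Complex.real_smul]
  push_cast
  rfl

/-- This scale invariance bounds the Littlewood–Paley partial sums in L¹ uniformly. -/
theorem SchwartzMap.integral_norm_fourier_dilate (k : ℤ) (ψ : 𝓢(V, ℂ)) :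
    ∫ ξ, ‖𝓕 (dilate k ψ) ξ‖ = ∫ ξ, ‖𝓕 ψ ξ‖ := by
  simp_rw [fourier_dilate_apply, norm_mul]
  rw [integral_const_mul, Measure.integral_comp_smul volume (fun v ↦ ‖𝓕 ψ v‖),
    abs_of_pos (by positivity), norm_zpow, zpow_mul, zpow_natCast, smul_eq_mul, ← mul_assoc]
  rw [Complex.norm_ofNat, mul_inv_cancel₀ (by positivity), one_mul]

/-- The Hausdorff-Young inequality for Schwartz functions, up to a constant. -/
theorem SchwartzMap.eLpNorm_fourier_le {p r : ℝ} (hpr : p.HolderConjugate r) (hp2 : p < 2) :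
    ∃ C : ℝ≥0, ∀ g : 𝓢(V, ℂ), eLpNorm (𝓕 g : 𝓢(V, ℂ)) (ENNReal.ofReal r) volume ≤
      C * eLpNorm g (ENNReal.ofReal p) volume := by
  obtain ⟨C, hC, h⟩ := lintegral_fourier_rpow_le (V := V) hpr hp2
  have hp := hpr.pos
  have hr := hpr.symm.pos
  refine ⟨(C ^ (1 / r)).toNNReal, fun g ↦ ?_⟩
  rw [eLpNorm_eq_lintegral_rpow_enorm_toReal (by simpa using hr) (by simp),
    eLpNorm_eq_lintegral_rpow_enorm_toReal (by simpa using hp) (by simp),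
    ENNReal.toReal_ofReal hp.le, ENNReal.toReal_ofReal hr.le]
  have e (f : 𝓢(V, ℂ)) {a : ℝ} (ha : 0 < a) (x : V) : ‖f x‖ₑ ^ a = ENNReal.ofReal (‖f x‖ ^ a) := by
    rw [← ofReal_norm, ENNReal.ofReal_rpow_of_nonneg (norm_nonneg _) ha.le]
  simp_rw [e _ hr, e _ hp]
  grw [h g]
  rw [← ofReal_integral_eq_lintegral_ofReal (g.integrable_norm_rpow hp)
    (ae_of_all _ fun x ↦ by positivity)]
  have hA : 0 ≤ ∫ x, ‖g x‖ ^ p := integral_nonneg fun x ↦ by positivity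
  rw [ENNReal.ofReal_rpow_of_nonneg (by positivity) (by positivity),
    ENNReal.ofReal_rpow_of_nonneg hA (by positivity),
    Real.mul_rpow hC (by positivity), ← Real.rpow_mul hA, ENNReal.ofReal_mul (by positivity)]
  have : (r - 1) * (1 / r) = 1 / p := by
    have := hpr.mul_eq_add
    field_simp
    linarith
  rw [this]
  rfl

end Dilation

/-! ### Littlewood–Paley decomposition of the pairing. -/

namespace RoughPDO

section Cutoff

variable {n : ℕ} {χ : Rn n → ℝ}

theorem IsCutoff.hasCompactSupport (hχ : IsCutoff χ) :
    HasCompactSupport (fun ξ ↦ (χ ξ : ℂ)) := by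
  refine HasCompactSupport.of_support_subset_isCompact (isCompact_closedBall (0 : Rn n) 2)
    fun ξ hξ ↦ ?_
  by_contra h
  simp only [Metric.mem_closedBall, dist_zero_right, not_le] at h
  simp [hχ.eq_zero ξ h] at hξ

/-- The cutoff as a Schwartz function. -/
noncomputable def IsCutoff.schwartz (hχ : IsCutoff χ) : 𝓢(Rn n, ℂ) :=
  hχ.hasCompactSupport.toSchwartzMap (Complex.ofRealCLM.contDiff.comp hχ.smooth)

theorem IsCutoff.schwartz_apply (hχ : IsCutoff χ) (ξ : Rn n) : hχ.schwartz ξ = (χ ξ : ℂ) := rfl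

/-- The dyadic shell `ξ ↦ φ (2⁻ˡ ξ)` as a Schwartz function. -/
noncomputable def IsCutoff.shell (hχ : IsCutoff χ) (l : ℤ) : 𝓢(Rn n, ℂ) :=
  dilate l hχ.schwartz - dilate (l - 1) hχ.schwartz

theorem IsCutoff.shell_eq_dilate (hχ : IsCutoff χ) (l : ℤ) :
    hχ.shell l = dilate l (hχ.shell 0) := by
  ext x
  simp only [shell, sub_apply, dilate_apply, smul_smul]
  rw [← zpow_add₀ two_ne_zero, ← zpow_add₀ two_ne_zero]
  congr 4 <;> ring

theorem IsCutoff.coe_shell_zero (hχ : IsCutoff χ) : (hχ.shell 0 : Rn n → ℂ) = bump χ := by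
  ext x
  simp [shell, dilate_apply, bump, schwartz_apply]

theorem IsCutoff.shell_neg (hχ : IsCutoff χ) (l : ℤ) (x : Rn n) :
    hχ.shell l (-x) = hχ.shell l x := by
  simp [shell, dilate_apply, schwartz_apply, hχ.even]

theorem littlewoodPaley_eq (hχ : IsCutoff χ) (l : ℤ) (g : Rn n → ℂ) (ξ : Rn n) :
    littlewoodPaley χ l g ξ = ∫ η, 𝓕 (hχ.shell l) (ξ - η) * g η := by
  simp_rw [hχ.shell_eq_dilate l, fourier_dilate_apply, mul_assoc]
  rw [littlewoodPaley, integral_const_mul, ← hχ.coe_shell_zero, finrank_euclideanSpace_fin]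
  rfl

theorem aestronglyMeasurable_littlewoodPaley (hχ : IsCutoff χ) (l : ℤ) {g : Rn n → ℂ}
    (hg : AEStronglyMeasurable g volume) :
    AEStronglyMeasurable (littlewoodPaley χ l g) volume := by
  have h : AEStronglyMeasurable
      (fun p : Rn n × Rn n ↦ 𝓕 (hχ.shell l) (p.1 - p.2) * g p.2) (volume.prod volume) :=
    ((𝓕 (hχ.shell l)).continuous.comp (continuous_fst.sub continuous_snd)).aestronglyMeasurable.mul
      hg.comp_snd
  exact h.integral_prod_right'.congr (ae_of_all _ fun ξ ↦ (littlewoodPaley_eq hχ l g ξ).symm)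

/-- The Littlewood-Paley operator is dual to multiplication by a dyadic shell. -/
theorem integral_littlewoodPaley_mul (hχ : IsCutoff χ) (l : ℤ) {g : Rn n → ℂ}
    (hg : VanishesWeakly g volume) (u : 𝓢(Rn n, ℂ)) :
    ∫ ξ, littlewoodPaley χ l g ξ * 𝓕 u ξ = ∫ η, g η * 𝓕 (mulMap (hχ.shell l) u) η := by
  simp_rw [littlewoodPaley_eq hχ, fourier_mulMap_apply]
  rw [hg.integral_convolution_mul]
  congr! 5 with η ξ
  rw [← fourier_neg_of_even (hχ.shell_neg l), neg_sub]

/-- The wider cutoff equals 1 on the ball |x| ≤ 2^(l+1) carrying the shell. Hence u stays localized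
after the shell has been moved onto g as P_l. -/
theorem mulMap_shell_dilate (hχ : IsCutoff χ) (l : ℤ) (u : 𝓢(Rn n, ℂ)) :
    mulMap (hχ.shell l) (mulMap (dilate (l + 1) hχ.schwartz) u) = mulMap (hχ.shell l) u := by
  ext x
  simp only [mulMap_apply, dilate_apply, IsCutoff.shell, sub_apply,
    IsCutoff.schwartz_apply]
  have h2 : (0 : ℝ) < 2 ^ (-(l + 1)) := by positivity
  rcases le_or_gt ‖(2 : ℝ) ^ (-(l + 1)) • x‖ 1 with h | h
  · rw [hχ.eq_one _ h, Complex.ofReal_one, one_mul]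
  · rw [norm_smul, Real.norm_of_nonneg h2.le] at h
    have e1 : (2 : ℝ) ^ (-l) = 2 * 2 ^ (-(l + 1)) := by
      rw [← zpow_one_add₀ two_ne_zero]; congr 1; ring
    have e2 : (2 : ℝ) ^ (-(l - 1)) = 4 * 2 ^ (-(l + 1)) := by
      rw [show (4 : ℝ) = 2 ^ (2 : ℤ) by norm_num, ← zpow_add₀ two_ne_zero]; congr 1; ring
    rw [hχ.eq_zero ((2 : ℝ) ^ (-l) • x), hχ.eq_zero ((2 : ℝ) ^ (-(l - 1)) • x)]
    · simp
    · rw [norm_smul, e2, Real.norm_of_nonneg (by positivity)]; linarith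
    · rw [norm_smul, e1, Real.norm_of_nonneg (by positivity)]; linarith

/-- A telescoping sum over 1 - N ≤ l ≤ N. -/
theorem IsCutoff.sum_shell (hχ : IsCutoff χ) (N : ℕ) :
    ∑ i ∈ Finset.range (2 * N), hχ.shell (i + (1 - N : ℤ)) =
      dilate N hχ.schwartz - dilate (-N) hχ.schwartz := by
  have h := Finset.sum_range_sub (fun i : ℕ ↦ dilate (i - N : ℤ) hχ.schwartz) (2 * N)
  rw [show (((2 * N : ℕ) : ℤ) - N) = N by push_cast; ring,
    show (((0 : ℕ) : ℤ) - N) = -N by push_cast; ring] at h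
  rw [← h]
  refine Finset.sum_congr rfl fun i _ ↦ ?_
  rw [shell]
  congr 2
  · push_cast; ring
  · ring

theorem IsCutoff.exists_norm_le (hχ : IsCutoff χ) : ∃ K : ℝ, 0 ≤ K ∧ ∀ ξ, |χ ξ| ≤ K := by
  refine ⟨SchwartzMap.seminorm ℝ 0 0 hχ.schwartz, apply_nonneg _ _, fun ξ ↦ ?_⟩
  simpa [schwartz_apply] using norm_le_seminorm ℝ hχ.schwartz ξ

theorem tendsto_cutoff_sub (hχ : IsCutoff χ) {x : Rn n} (hx : x ≠ 0) :
    ∀ᶠ N : ℕ in Filter.atTop,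
      (dilate (N : ℤ) hχ.schwartz - dilate (-(N : ℤ)) hχ.schwartz) x = 1 := by
  have hx' : 0 < ‖x‖ := norm_pos_iff.2 hx
  have ht := tendsto_pow_atTop_atTop_of_one_lt (one_lt_two (α := ℝ))
  filter_upwards [ht.eventually_ge_atTop ‖x‖, ht.eventually_gt_atTop (2 / ‖x‖)] with N h1 h2
  simp only [sub_apply, dilate_apply, IsCutoff.schwartz_apply]
  rw [hχ.eq_one, hχ.eq_zero]
  · simp
  · rw [norm_smul, neg_neg, zpow_natCast, Real.norm_of_nonneg (by positivity)]
    rwa [div_lt_iff₀ hx'] at h2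
  · rw [norm_smul, zpow_neg, zpow_natCast, Real.norm_of_nonneg (by positivity)]
    rwa [inv_mul_le_iff₀ (by positivity), mul_one]

/-- The remainder v N has transform bounded in L¹ by Young's inequality and scale invariance, and
bounded uniformly by ‖v N‖₁, which tends to 0 by dominated convergence. -/
theorem tendsto_integral_mul_fourier_mulMap (hn : 1 ≤ n) (hχ : IsCutoff χ) {g : Rn n → ℂ}
    (hg : VanishesWeakly g volume) (u : 𝓢(Rn n, ℂ)) :
    Filter.Tendsto (fun N : ℕ ↦ ∫ ξ, g ξ *
      𝓕 (mulMap (dilate (N : ℤ) hχ.schwartz - dilate (-(N : ℤ)) hχ.schwartz) u) ξ)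
      Filter.atTop (nhds (∫ ξ, g ξ * 𝓕 u ξ)) := by
  set ψ := hχ.schwartz
  set w : ℕ → 𝓢(Rn n, ℂ) := fun N ↦ dilate (N : ℤ) ψ - dilate (-(N : ℤ)) ψ with hw
  set v : ℕ → 𝓢(Rn n, ℂ) := fun N ↦ u - mulMap (w N) u with hv
  have hint (f : 𝓢(Rn n, ℂ)) : Integrable (fun ξ ↦ g ξ * 𝓕 f ξ) :=
    hg.integrable_mul (𝓕 f).integrable (norm_le_seminorm ℝ (𝓕 f))
  have hFv (N : ℕ) (ξ : Rn n) : 𝓕 (v N) ξ = 𝓕 u ξ - 𝓕 (mulMap (w N) u) ξ := by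
    have : 𝓕 (v N) = 𝓕 u - 𝓕 (mulMap (w N) u) := by
      simp only [hv, sub_eq_add_neg, FourierTransform.fourier_add, FourierTransform.fourier_neg]
    rw [this, sub_apply]
  have hwF (N : ℕ) (ξ : Rn n) : 𝓕 (mulMap (w N) u) ξ =
      𝓕 (mulMap (dilate (N : ℤ) ψ) u) ξ - 𝓕 (mulMap (dilate (-(N : ℤ)) ψ) u) ξ := by
    have e : mulMap (w N) u =
        mulMap (dilate (N : ℤ) ψ) u - mulMap (dilate (-(N : ℤ)) ψ) u := by
      ext x; simp [hw, sub_mul]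
    rw [e, ← sub_apply]
    congr 1
    simp only [sub_eq_add_neg, FourierTransform.fourier_add, FourierTransform.fourier_neg]
  obtain ⟨K, hK0, hK⟩ := hχ.exists_norm_le
  have hKψ (x : Rn n) : ‖ψ x‖ ≤ K := by simpa [ψ, IsCutoff.schwartz_apply] using hK x
  set B := ∫ ξ, ‖𝓕 ψ ξ‖
  set U := ∫ ξ, ‖𝓕 u ξ‖
  have hM (N : ℕ) : ∫ ξ, ‖𝓕 (v N) ξ‖ ≤ U + (B * U + B * U) := by
    have i (f : 𝓢(Rn n, ℂ)) : Integrable (fun ξ ↦ ‖𝓕 f ξ‖) := (𝓕 f).integrable.norm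
    have i2 (f₁ f₂ : 𝓢(Rn n, ℂ)) : Integrable (fun ξ ↦ ‖𝓕 f₁ ξ‖ + ‖𝓕 f₂ ξ‖) := (i f₁).add (i f₂)
    have hd (k : ℤ) : ∫ ξ, ‖𝓕 (mulMap (dilate k ψ) u) ξ‖ ≤ B * U := by
      refine (integral_norm_fourier_mulMap_le _ _).trans_eq ?_
      rw [integral_norm_fourier_dilate]
    calc ∫ ξ, ‖𝓕 (v N) ξ‖ ≤ ∫ ξ, (‖𝓕 u ξ‖ + (‖𝓕 (mulMap (dilate (N : ℤ) ψ) u) ξ‖ +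
          ‖𝓕 (mulMap (dilate (-(N : ℤ)) ψ) u) ξ‖)) := by
          refine integral_mono (i _) ((i _).add (i2 _ _)) fun ξ ↦ ?_
          simp only [hFv, hwF]
          exact (norm_sub_le _ _).trans (by gcongr; exact norm_sub_le _ _)
      _ ≤ _ := by
          rw [integral_add (i _) (i2 _ _), integral_add (i _) (i _)]
          gcongr <;> exact hd _
  -- The cutoffs converge to 1 only off the origin, a null set because n ≥ 1.
  have : Nontrivial (Rn n) := by
    apply Module.nontrivial_of_finrank_pos (R := ℝ)
    rw [finrank_euclideanSpace_fin]; omega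
  have hδ : Filter.Tendsto (fun N ↦ ∫ x, ‖v N x‖) Filter.atTop (nhds 0) := by
    have := tendsto_integral_of_dominated_convergence (F := fun N x ↦ ‖v N x‖) (f := fun _ ↦ 0)
      (μ := volume) (fun x ↦ (1 + (K + K)) * ‖u x‖)
      (fun N ↦ (v N).continuous.norm.aestronglyMeasurable) (u.integrable.norm.const_mul _)
      (fun N ↦ ae_of_all _ fun x ↦ ?_) ?_
    · simpa using this
    · have e : v N x = (1 - w N x) * u x := by simp [hv, sub_mul]
      rw [norm_norm, e, norm_mul]
      gcongr
      refine (norm_sub_le _ _).trans ?_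
      rw [norm_one]
      gcongr
      simp only [hw, sub_apply, dilate_apply]
      exact (norm_sub_le _ _).trans (add_le_add (hKψ _) (hKψ _))
    · filter_upwards [compl_mem_ae_iff.2 (measure_singleton (0 : Rn n))] with x hx
      refine tendsto_const_nhds.congr' ?_
      filter_upwards [tendsto_cutoff_sub hχ hx] with N hN
      have e : v N x = (1 - w N x) * u x := by simp [hv, sub_mul]
      rw [e, show w N x = 1 from hN]
      simp
  have hlim := hg.tendsto_integral_mul (h := fun N ↦ (𝓕 (v N) : 𝓢(Rn n, ℂ))) (fun N ↦ (𝓕 (v N)).integrable) hM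
    (fun N ξ ↦ (norm_fourier_apply_le_toLp_one (v N) ξ).trans_eq norm_toLp_one) hδ
  have hsub (N : ℕ) : ∫ ξ, g ξ * 𝓕 (mulMap (w N) u) ξ =
      (∫ ξ, g ξ * 𝓕 u ξ) - ∫ ξ, g ξ * 𝓕 (v N) ξ := by
    rw [← integral_sub (hint _) (hint _)]
    congr! 2 with ξ
    rw [hFv]; ring
  refine (Filter.tendsto_congr hsub).2 ?_
  simpa using hlim.const_sub (∫ ξ, g ξ * 𝓕 u ξ)

/-- A weakly vanishing function pairs with a Fourier transform through its
Littlewood-Paley pieces. -/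
theorem enorm_integral_mul_fourier_le (hn : 1 ≤ n) (hχ : IsCutoff χ) {g : Rn n → ℂ}
    (hg : VanishesWeakly g volume) (u : 𝓢(Rn n, ℂ)) :
    ‖∫ ξ, g ξ * 𝓕 u ξ‖ₑ ≤ ∑' l : ℤ,
      ‖∫ ξ, littlewoodPaley χ l g ξ * 𝓕 (mulMap (dilate (l + 1) hχ.schwartz) u) ξ‖ₑ := by
  refine le_of_tendsto (tendsto_integral_mul_fourier_mulMap hn hχ hg u).enorm
    (Filter.Eventually.of_forall fun N ↦ ?_)
  have e : 𝓕 (mulMap (dilate (N : ℤ) hχ.schwartz - dilate (-(N : ℤ)) hχ.schwartz) u) =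
      ∑ i ∈ Finset.range (2 * N), 𝓕 (mulMap (hχ.shell (i + (1 - N : ℤ))) u) := by
    have h1 : mulMap (dilate (N : ℤ) hχ.schwartz - dilate (-(N : ℤ)) hχ.schwartz) u =
        ∑ i ∈ Finset.range (2 * N), mulMap (hχ.shell (i + (1 - N : ℤ))) u := by
      rw [← hχ.sum_shell]
      simp [mulMap]
    rw [h1]
    exact map_sum (FourierTransform.fourierCLM ℂ 𝓢(Rn n, ℂ)) _ _
  have hint (f : 𝓢(Rn n, ℂ)) : Integrable (fun ξ ↦ g ξ * 𝓕 f ξ) :=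
    hg.integrable_mul (𝓕 f).integrable (norm_le_seminorm ℝ (𝓕 f))
  rw [e]
  simp_rw [sum_apply, Finset.mul_sum]
  rw [integral_finsetSum _ fun i _ ↦ hint _]
  refine (enorm_sum_le _ _).trans ?_
  -- Distinct indices give distinct l, so the finite sum is part of the sum over ℤ.
  have hinj : Function.Injective (fun i : ℕ ↦ (i + (1 - N : ℤ))) := fun a b h ↦ by
    simpa using h
  have e2 (l : ℤ) : ∫ ξ, g ξ * 𝓕 (mulMap (hχ.shell l) u) ξ =
      ∫ ξ, littlewoodPaley χ l g ξ * 𝓕 (mulMap (dilate (l + 1) hχ.schwartz) u) ξ := by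
    rw [integral_littlewoodPaley_mul hχ l hg, mulMap_shell_dilate]
  simp_rw [e2]
  refine (Finset.sum_map (Finset.range (2 * N)) ⟨_, hinj⟩ fun l : ℤ ↦
    ‖∫ ξ, littlewoodPaley χ l g ξ * 𝓕 (mulMap (dilate (l + 1) hχ.schwartz) u) ξ‖ₑ).symm.trans_le ?_
  exact ENNReal.sum_le_tsum _

theorem enorm_integral_mul_fourier_le_tsum_eLpNorm (hn : 1 ≤ n) (hχ : IsCutoff χ) {p : ℝ}
    (hp1 : 1 < p) (hp2 : p < 2) :
    ∃ C : ℝ≥0, ∀ g : Rn n → ℂ, VanishesWeakly g volume → ∀ u : 𝓢(Rn n, ℂ),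
      ‖∫ ξ, g ξ * 𝓕 u ξ‖ₑ ≤ ∑' l : ℤ,
        C * (eLpNorm (littlewoodPaley χ l g) (ENNReal.ofReal p) volume *
          eLpNorm (mulMap (dilate (l + 1) hχ.schwartz) u) (ENNReal.ofReal p) volume) := by
  have hpr : p.HolderConjugate p.conjExponent := Real.HolderConjugate.conjExponent hp1
  obtain ⟨C, hC⟩ := eLpNorm_fourier_le (V := Rn n) hpr hp2
  refine ⟨C, fun g hg u ↦ (enorm_integral_mul_fourier_le hn hχ hg u).trans
    (ENNReal.tsum_le_tsum fun l ↦ ?_)⟩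
  set v := mulMap (dilate (l + 1) hχ.schwartz) u
  have hm := aestronglyMeasurable_littlewoodPaley hχ l hg.aestronglyMeasurable
  calc ‖∫ ξ, littlewoodPaley χ l g ξ * 𝓕 v ξ‖ₑ
      ≤ ∫⁻ ξ, ‖littlewoodPaley χ l g ξ‖ₑ * ‖𝓕 v ξ‖ₑ := by
        refine (enorm_integral_le_lintegral_enorm _).trans_eq ?_
        simp_rw [enorm_mul]
    _ ≤ eLpNorm (littlewoodPaley χ l g) (ENNReal.ofReal p) volume *
          eLpNorm (𝓕 v : 𝓢(Rn n, ℂ)) (ENNReal.ofReal p.conjExponent) volume := by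
        rw [eLpNorm_eq_lintegral_rpow_enorm_toReal (by simpa using hpr.pos) (by simp),
          eLpNorm_eq_lintegral_rpow_enorm_toReal (by simpa using hpr.symm.pos) (by simp),
          ENNReal.toReal_ofReal hpr.nonneg, ENNReal.toReal_ofReal hpr.symm.nonneg]
        exact ENNReal.lintegral_mul_le_Lp_mul_Lq volume hpr hm.enorm
          (𝓕 v).continuous.aestronglyMeasurable.enorm
    _ ≤ _ := by
        grw [hC v]
        exact le_of_eq (by ring)

end Cutoff

end RoughPDO

/-! ### The a priori estimate on Schwartz functions. -/

/-- Minkowski's inequality for countable sums of nonnegative functions. -/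
theorem lintegral_tsum_rpow_le {α ι : Type*} [Countable ι] {_ : MeasurableSpace α} {μ : Measure α}
    {p : ℝ} (hp : 1 ≤ p) {F : ι → α → ℝ≥0∞} (hF : ∀ i, AEMeasurable (F i) μ) :
    (∫⁻ x, (∑' i, F i x) ^ p ∂μ) ^ (1 / p) ≤ ∑' i, (∫⁻ x, F i x ^ p ∂μ) ^ (1 / p) := by
  have hp0 : 0 < p := by linarith
  rw [one_div, ENNReal.rpow_inv_le_iff hp0]
  have h1 (x : α) : (∑' i, F i x) ^ p = ⨆ s : Finset ι, (∑ i ∈ s, F i x) ^ p := by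
    rw [ENNReal.tsum_eq_iSup_sum]
    exact (ENNReal.orderIsoRpow p hp0).map_iSup _
  simp_rw [h1]
  -- Monotone convergence over finite partial sums reduces to the finite triangle inequality.
  rw [lintegral_iSup_directed]
  · refine iSup_le fun s ↦ ?_
    rw [← ENNReal.rpow_inv_le_iff hp0]
    have h2 := eLpNorm_sum_le (p := ENNReal.ofReal p) (s := s) (f := F) (μ := μ)
      (fun i _ ↦ (hF i).aestronglyMeasurable) (by simpa using hp)
    simp_rw [eLpNorm_eq_lintegral_rpow_enorm_toReal (p := ENNReal.ofReal p) (by simpa using hp0)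
      ENNReal.ofReal_ne_top, ENNReal.toReal_ofReal hp0.le, enorm_eq_self, Finset.sum_apply,
      one_div] at h2
    exact h2.trans (ENNReal.sum_le_tsum _)
  · intro s
    exact (Finset.aemeasurable_fun_sum s fun i _ ↦ hF i).pow_const p
  · refine Monotone.directed_le fun s t hst x ↦ ?_
    exact ENNReal.rpow_le_rpow (Finset.sum_le_sum_of_subset hst) hp0.le

namespace RoughPDO

variable {n : ℕ} {χ : Rn n → ℝ}

/-- Modulation on the Fourier side is translation of f; subtracting `-x` produces f(· + x). -/
theorem pdo_eq (σ : Rn n → Rn n → ℂ) (f : 𝓢(Rn n, ℂ)) (x : Rn n) :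
    pdo σ f x = ∫ ξ, σ x ξ * 𝓕 (f.compSubConstCLM ℂ (-x)) ξ := by
  have h (ξ : Rn n) : 𝓕 (f.compSubConstCLM ℂ (-x)) ξ =
      Complex.exp (2 * Real.pi * Complex.I * (inner ℝ ξ x : ℝ)) * 𝓕 (f : Rn n → ℂ) ξ := by
    have h1 := congrFun (VectorFourier.fourierIntegral_comp_add_right Real.fourierChar volume
      (innerₗ (Rn n)) (f : Rn n → ℂ) x) ξ
    have h2 : 𝓕 (f.compSubConstCLM ℂ (-x)) ξ = VectorFourier.fourierIntegral Real.fourierChar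
        volume (innerₗ (Rn n)) ((f : Rn n → ℂ) ∘ fun v ↦ v + x) ξ := by
      refine congrArg (fun F : Rn n → ℂ ↦ 𝓕 F ξ) (funext fun v ↦ ?_)
      simp
    rw [h2, h1, Circle.smul_def, Real.fourierChar_apply, smul_eq_mul]
    congr 1
    rw [innerₗ_apply_apply, real_inner_comm]
    congr 1
    push_cast
    ring
  simp_rw [pdo, h, mul_assoc]

theorem IsSymbol.vanishesWeakly {σ : Rn n → Rn n → ℂ} (hσ : IsSymbol σ) (x : Rn n) :
    VanishesWeakly (σ x) volume := hσ.vanishing x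

theorem IsSymbol.integrable_mul_fourier {σ : Rn n → Rn n → ℂ} (hσ : IsSymbol σ) (x : Rn n)
    (u : 𝓢(Rn n, ℂ)) : Integrable (fun ξ ↦ σ x ξ * 𝓕 u ξ) :=
  (hσ.vanishesWeakly x).integrable_mul (𝓕 u).integrable (norm_le_seminorm ℝ (𝓕 u))

theorem IsSymbol.pdo_add {σ : Rn n → Rn n → ℂ} (hσ : IsSymbol σ) (f g : 𝓢(Rn n, ℂ)) :
    pdo σ (f + g) = pdo σ f + pdo σ g := by
  ext x
  simp only [Pi.add_apply, pdo_eq, map_add, FourierTransform.fourier_add, add_apply, mul_add]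
  exact integral_add (hσ.integrable_mul_fourier x _) (hσ.integrable_mul_fourier x _)

theorem pdo_smul (σ : Rn n → Rn n → ℂ) (c : ℂ) (f : 𝓢(Rn n, ℂ)) :
    pdo σ (c • f) = c • pdo σ f := by
  ext x
  simp only [Pi.smul_apply, pdo_eq, map_smul, FourierTransform.fourier_smul, smul_apply,
    mul_smul_comm]
  exact integral_smul _ _

theorem IsSymbol.aestronglyMeasurable_pdo {σ : Rn n → Rn n → ℂ} (hσ : IsSymbol σ)
    (f : 𝓢(Rn n, ℂ)) : AEStronglyMeasurable (pdo σ f) volume := by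
  have h : AEStronglyMeasurable (fun y : Rn n × Rn n ↦ σ y.1 y.2 *
      Complex.exp (2 * Real.pi * Complex.I * (inner ℝ y.2 y.1 : ℝ)) * 𝓕 (f : Rn n → ℂ) y.2)
      (volume.prod volume) := by
    refine (hσ.measurable.mul (Continuous.aestronglyMeasurable ?_)).mul
      ((𝓕 f).continuous.comp continuous_snd).aestronglyMeasurable
    fun_prop
  exact h.integral_prod_right'

/-- The local `Lᵖ` norm, raised to the power `p`, over the ball of radius `R` around `x`. -/
noncomputable def localPow (p R : ℝ) (f : 𝓢(Rn n, ℂ)) (x : Rn n) : ℝ≥0∞ :=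
  ∫⁻ z in Metric.closedBall 0 R, ‖f (z + x)‖ₑ ^ p

theorem measurable_localPow (p R : ℝ) (f : 𝓢(Rn n, ℂ)) : Measurable (localPow p R f) := by
  have h : Measurable fun y : Rn n × Rn n ↦ ‖f (y.2 + y.1)‖ₑ ^ p :=
    (f.continuous.measurable.comp (measurable_snd.add measurable_fst)).enorm.pow_const p
  exact h.lintegral_prod_right'

/-- By Tonelli and translation invariance every z in the ball contributes equally. -/
theorem lintegral_localPow (p R : ℝ) (f : 𝓢(Rn n, ℂ)) :
    ∫⁻ x, localPow p R f x =
      volume (Metric.closedBall (0 : Rn n) R) * ∫⁻ x, ‖f x‖ₑ ^ p := by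
  have h : Measurable fun y : Rn n × Rn n ↦ ‖f (y.2 + y.1)‖ₑ ^ p :=
    (f.continuous.measurable.comp (measurable_snd.add measurable_fst)).enorm.pow_const p
  simp_rw [localPow]
  rw [lintegral_lintegral_swap h.aemeasurable]
  simp_rw [lintegral_add_left_eq_self (fun x ↦ ‖f x‖ₑ ^ p)]
  rw [lintegral_const, Measure.restrict_apply_univ, mul_comm]

theorem eLpNorm_mulMap_dilate_le (hχ : IsCutoff χ) {K p : ℝ} (hp : 0 < p)
    (hK : ∀ ξ, |χ ξ| ≤ K) (k : ℤ) (f : 𝓢(Rn n, ℂ)) (x : Rn n) :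
    eLpNorm (mulMap (dilate k hχ.schwartz) (f.compSubConstCLM ℂ (-x))) (ENNReal.ofReal p) volume ≤
      ENNReal.ofReal K * localPow p (2 ^ (k + 1)) f x ^ (1 / p) := by
  have hb : ∀ z : Rn n, ‖mulMap (dilate k hχ.schwartz) (f.compSubConstCLM ℂ (-x)) z‖ ≤
      K * ‖(Metric.closedBall (0 : Rn n) (2 ^ (k + 1))).indicator (fun z ↦ f (z + x)) z‖ := by
    intro z
    simp only [mulMap_apply, dilate_apply, IsCutoff.schwartz_apply, compSubConstCLM_apply,
      sub_neg_eq_add, norm_mul, Complex.norm_real, Real.norm_eq_abs]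
    by_cases hz : z ∈ Metric.closedBall (0 : Rn n) (2 ^ (k + 1))
    · rw [Set.indicator_of_mem hz]
      gcongr
      exact hK _
    · rw [hχ.eq_zero]
      · simp [Set.indicator_of_notMem hz]
      · rw [mem_closedBall_zero_iff, not_le] at hz
        rw [norm_smul, zpow_neg, Real.norm_of_nonneg (by positivity), inv_mul_eq_div,
          lt_div_iff₀ (by positivity), ← zpow_one_add₀ two_ne_zero, add_comm]
        exact hz
  refine (eLpNorm_le_mul_eLpNorm_of_ae_le_mul (ae_of_all _ hb) _).trans_eq ?_
  rw [eLpNorm_indicator_eq_eLpNorm_restrict Metric.isClosed_closedBall.measurableSet,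
    eLpNorm_eq_lintegral_rpow_enorm_toReal (by simpa using hp) ENNReal.ofReal_ne_top,
    ENNReal.toReal_ofReal hp.le]
  rfl

/-- The source of the weight in `symbolNorm`: the radius is 2^l · 4, and the ball of radius 4 goes
into the constant. -/
theorem volume_closedBall_zpow_rpow {p : ℝ} (hp : 0 < p) (l : ℤ) :
    volume (Metric.closedBall (0 : Rn n) (2 ^ (l + 2))) ^ (1 / p) =
      (2 : ℝ≥0∞) ^ ((l : ℝ) * n / p) *
        volume (Metric.closedBall (0 : Rn n) 4) ^ (1 / p) := by
  have e : ENNReal.ofReal (((2 : ℝ) ^ l) ^ n) = (2 : ℝ≥0∞) ^ ((l : ℝ) * n) := by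
    rw [← Real.rpow_intCast, ← Real.rpow_natCast, ← Real.rpow_mul zero_le_two,
      ← ENNReal.ofReal_rpow_of_pos two_pos, ENNReal.ofReal_ofNat]
  rw [Measure.addHaar_closedBall _ _ (by positivity), Measure.addHaar_closedBall _ _ (by norm_num),
    finrank_euclideanSpace_fin, zpow_add₀ two_ne_zero, mul_pow, ENNReal.ofReal_mul (by positivity),
    mul_assoc, e, div_eq_mul_one_div ((l : ℝ) * n) p, ENNReal.rpow_mul _ _ (1 / p),
    ENNReal.mul_rpow_of_nonneg _ _ (by positivity), show (2 : ℝ) ^ (2 : ℤ) = 4 by norm_num]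

/-- The a priori estimate for pseudodifferential operators on Schwartz functions. -/
theorem eLpNorm_pdo_le (hn : 1 ≤ n) (hχ : IsCutoff χ) {p : ℝ} (hp1 : 1 < p) (hp2 : p < 2) :
    ∃ C : ℝ≥0, ∀ σ : Rn n → Rn n → ℂ, IsSymbol σ → ∀ f : 𝓢(Rn n, ℂ),
      eLpNorm (pdo σ f) (ENNReal.ofReal p) volume ≤
        C * symbolNorm χ (ENNReal.ofReal p) σ * eLpNorm f (ENNReal.ofReal p) volume := by
  have hp0 : 0 < p := by linarith
  obtain ⟨C, hC⟩ := enorm_integral_mul_fourier_le_tsum_eLpNorm hn hχ hp1 hp2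
  obtain ⟨K, -, hK⟩ := hχ.exists_norm_le
  set W : ℝ≥0∞ := volume (Metric.closedBall (0 : Rn n) 4) ^ (1 / p) with hW
  have hWtop : W ≠ ⊤ := by
    refine ENNReal.rpow_ne_top_of_nonneg (by positivity) ?_
    exact measure_closedBall_lt_top.ne
  refine ⟨C * K.toNNReal * W.toNNReal, fun σ hσ f ↦ ?_⟩
  set A : ℤ → ℝ≥0∞ := fun l ↦
    ⨆ x : Rn n, eLpNorm (littlewoodPaley χ l (σ x)) (ENNReal.ofReal p) volume with hA
  -- The supremum over x is taken here, so that only the local norm of f still depends on x when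
  -- integrating.
  set F : ℤ → Rn n → ℝ≥0∞ := fun l x ↦
    C * A l * ENNReal.ofReal K * localPow p (2 ^ (l + 2)) f x ^ (1 / p) with hF
  have hpt (x : Rn n) : ‖pdo σ f x‖ₑ ≤ ∑' l, F l x := by
    rw [pdo_eq]
    refine (hC (σ x) (hσ.vanishesWeakly x) _).trans (ENNReal.tsum_le_tsum fun l ↦ ?_)
    grw [eLpNorm_mulMap_dilate_le hχ hp0 hK (l + 1) f x,
      le_iSup (fun x ↦ eLpNorm (littlewoodPaley χ l (σ x)) (ENNReal.ofReal p) volume) x]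
    rw [show l + 1 + 1 = l + 2 by ring]
    exact le_of_eq (by simp only [hF, hA]; ring)
  have hFm (l : ℤ) : AEMeasurable (F l) volume :=
    (((measurable_localPow p (2 ^ (l + 2)) f).pow_const _).const_mul _).aemeasurable
  set E := eLpNorm f (ENNReal.ofReal p) volume with hE
  have hEeq : E = (∫⁻ x, ‖f x‖ₑ ^ p) ^ (1 / p) := by
    rw [hE, eLpNorm_eq_lintegral_rpow_enorm_toReal (by simpa using hp0) ENNReal.ofReal_ne_top,
      ENNReal.toReal_ofReal hp0.le]
  have hFl (l : ℤ) : (∫⁻ x, F l x ^ p) ^ (1 / p) =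
      C * ENNReal.ofReal K * W * ((2 : ℝ≥0∞) ^ ((l : ℝ) * n / p) * A l) * E := by
    simp only [hF]
    simp_rw [ENNReal.mul_rpow_of_nonneg _ _ hp0.le, ← ENNReal.rpow_mul, one_div,
      inv_mul_cancel₀ hp0.ne', ENNReal.rpow_one]
    rw [lintegral_const_mul _ (measurable_localPow _ _ _), lintegral_localPow,
      ENNReal.mul_rpow_of_nonneg _ _ (by positivity), ENNReal.mul_rpow_of_nonneg _ _ (by positivity),
      ENNReal.mul_rpow_of_nonneg _ _ (by positivity), ENNReal.mul_rpow_of_nonneg _ _ (by positivity)]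
    simp_rw [← ENNReal.rpow_mul, mul_inv_cancel₀ hp0.ne', ENNReal.rpow_one]
    rw [← one_div, volume_closedBall_zpow_rpow hp0, ← hEeq]
    ring
  calc eLpNorm (pdo σ f) (ENNReal.ofReal p) volume
      = (∫⁻ x, ‖pdo σ f x‖ₑ ^ p) ^ (1 / p) := by
        rw [eLpNorm_eq_lintegral_rpow_enorm_toReal (by simpa using hp0) ENNReal.ofReal_ne_top,
          ENNReal.toReal_ofReal hp0.le]
    _ ≤ (∫⁻ x, (∑' l, F l x) ^ p) ^ (1 / p) := by
        gcongr with x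
        exact hpt x
    _ ≤ ∑' l, (∫⁻ x, F l x ^ p) ^ (1 / p) := lintegral_tsum_rpow_le hp1.le hFm
    _ = _ := by
        simp_rw [hFl]
        rw [ENNReal.tsum_mul_right, ENNReal.tsum_mul_left, symbolNorm,
          ENNReal.toReal_ofReal hp0.le]
        push_cast
        rw [ENNReal.coe_toNNReal hWtop]
        rfl

end RoughPDO

/-! ### Extension to L^q by density of Schwartz functions. -/

theorem mainTheorem4 (n : ℕ) (hn : 1 ≤ n) (χ : RoughPDO.Rn n → ℝ) (hχ : RoughPDO.IsCutoff χ)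
    (q : ℝ≥0∞) [Fact (1 ≤ q)] (hq₁ : 1 < q) (hq₂ : q < 2) :
    ∃ C : ℝ≥0, ∀ σ : RoughPDO.Rn n → RoughPDO.Rn n → ℂ, RoughPDO.IsSymbol σ →
      RoughPDO.symbolNorm χ q σ ≠ ⊤ →
      ∃ T : Lp ℂ q (volume : Measure (RoughPDO.Rn n)) →L[ℂ]
          Lp ℂ q (volume : Measure (RoughPDO.Rn n)),
        (∀ f : 𝓢(RoughPDO.Rn n, ℂ), T (f.toLp q) =ᵐ[volume] RoughPDO.pdo σ f) ∧
        ‖T‖ₑ ≤ C * RoughPDO.symbolNorm χ q σ := by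
  have hqt : q ≠ ⊤ := hq₂.ne_top
  have hqr : ENNReal.ofReal q.toReal = q := ENNReal.ofReal_toReal hqt
  have h1 : 1 < q.toReal := by
    rw [← ENNReal.toReal_one]
    exact (ENNReal.toReal_lt_toReal ENNReal.one_ne_top hqt).2 hq₁
  have h2 : q.toReal < 2 := by
    rw [← ENNReal.toReal_ofNat]
    exact (ENNReal.toReal_lt_toReal hqt ENNReal.ofNat_ne_top).2 hq₂
  obtain ⟨C, hC⟩ := RoughPDO.eLpNorm_pdo_le hn hχ h1 h2
  rw [hqr] at hC
  refine ⟨C, fun σ hσ hfin ↦ ?_⟩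
  set S := RoughPDO.symbolNorm χ q σ
  have hCS : C * S ≠ ⊤ := ENNReal.mul_ne_top ENNReal.coe_ne_top hfin
  have hmem (f : 𝓢(RoughPDO.Rn n, ℂ)) : MemLp (RoughPDO.pdo σ f) q volume := by
    refine ⟨hσ.aestronglyMeasurable_pdo f, (hC σ hσ f).trans_lt ?_⟩
    exact ENNReal.mul_lt_top hCS.lt_top (f.memLp q volume).2
  obtain ⟨T₀, hT₀⟩ : ∃ T₀ : 𝓢(RoughPDO.Rn n, ℂ) →ₗ[ℂ] Lp ℂ q (volume : Measure (RoughPDO.Rn n)),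
      ∀ f, T₀ f = (hmem f).toLp (RoughPDO.pdo σ f) :=
    ⟨{ toFun := fun f ↦ (hmem f).toLp (RoughPDO.pdo σ f)
       map_add' := fun f g ↦ by
        rw [← MemLp.toLp_add (hmem f) (hmem g)]
        exact MemLp.toLp_congr _ _ (by rw [hσ.pdo_add])
       map_smul' := fun c f ↦ by
        rw [RingHom.id_apply, ← MemLp.toLp_const_smul c (hmem f)]
        exact MemLp.toLp_congr _ _ (by rw [RoughPDO.pdo_smul]) }, fun _ ↦ rfl⟩
  obtain ⟨e, he⟩ : ∃ e : 𝓢(RoughPDO.Rn n, ℂ) →ₗ[ℂ] Lp ℂ q (volume : Measure (RoughPDO.Rn n)),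
      ∀ f, e f = f.toLp q := ⟨(SchwartzMap.toLpCLM ℂ ℂ q volume).toLinearMap, fun _ ↦ rfl⟩
  have hdense : DenseRange e := by
    have h := SchwartzMap.denseRange_toLpCLM (E := RoughPDO.Rn n) (F := ℂ) (μ := volume) hqt
    rwa [show (e : _ → _) = SchwartzMap.toLpCLM ℝ ℂ q volume from funext he]
  have hbound (f : 𝓢(RoughPDO.Rn n, ℂ)) : ‖T₀ f‖ ≤ (C * S).toReal * ‖e f‖ := by
    rw [hT₀, he, Lp.norm_toLp, SchwartzMap.norm_toLp, ← ENNReal.toReal_mul]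
    exact ENNReal.toReal_mono (ENNReal.mul_ne_top hCS (f.memLp q volume).2.ne) (hC σ hσ f)
  refine ⟨T₀.extendOfNorm e, fun f ↦ ?_, ?_⟩
  · rw [← he, LinearMap.extendOfNorm_eq hdense ⟨_, hbound⟩ f, hT₀]
    exact (hmem f).coeFn_toLp
  · rw [← ofReal_norm, ← ENNReal.ofReal_toReal hCS]
    exact ENNReal.ofReal_le_ofReal (ContinuousLinearMap.opNorm_le_bound _ ENNReal.toReal_nonneg
      (LinearMap.norm_extendOfNorm_apply_le hdense _ hbound))
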